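/- Let $1\le m\le n$ and let $\Omega\subset\mathbb R^n$ be a bounded domain (open and connected). For a symmetric $n\times n$ matrix $S$ let $T_p(S)$ be the sum of all principal $p\times p$ minors of $S$, $T_0(S)=1$; call $S$ *$k$-positive* if $T_p(S)>0$ for $p=1,\dots,k$ (so every symmetric matrix is $0$-positive). For $u=u(x,t)$ put $$E_m[u]=-u_t\,T_{m-1}(u_{xx})+T_m(u_{xx}),$$ where $u_{xx}$ is the Hesse matrix in $x$. The class $C^{2,1}(\bar\Omega\times[0,\infty))$ consists of the functions $u$ for which $u_t,u_x,u_{xx}$ exist in $\Omega\times[0,\infty)$ ($u_t$ one-sided at $t=0$) and $u,u_t,u_x,u_{xx}$ extend continuously to $\bar\Omega\times[0,\infty)$; $C^2(\bar\Omega)$ is understood likewise, and $\mathbf u\in C^2(\bar\Omega)$ is called *$m$-admissible* in $\bar\Omega$ if $\mathbf u_{xx}$ is $m$-positive at every point of $\bar\Omega$. **Theorem 3.1.** Let $f,\varphi,\mathbf f,\Phi$ be real functions such that (i) $f\ge\nu_m>0$ in $\Omega\times(0,\infty)$ for some constant $\nu_m$, and there is a point $x_0\in\Omega$ such that the matrix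 $\varphi_{xx}(x_0,0)$ is $(m-1)$-positive; (ii) $u\in C^{2,1}(\bar\Omega\times[0,\infty))$ satisfies $E_m[u]=f$ in $\Omega\times(0,\infty)$ and $u=\varphi$ on the parabolic boundary $(\Omega\times\{0\})\cup(\partial\Omega\times[0,\infty))$; (iii) $\mathbf u$ is $m$-admissible in $\bar\Omega$, $T_m(\mathbf u_{xx})=\mathbf f$ in $\Omega$ and $\mathbf u=\Phi$ on $\partial\Omega$; (iv) as $t\to\infty$, $f(x,t)\to\mathbf f(x)$ uniformly in $x\in\Omega$ and $\varphi(x,t)\to\Phi(x)$ uniformly in $x\in\partial\Omega$. Then $u(x,t)\to\mathbf u(x)$ as $t\to\infty$, uniformly in $x\in\bar\Omega$ (in particular at every point of $\bar\Omega$). -/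

import Mathlib

namespace MHessian

/-- The `p`-trace of a square matrix: the sum of all its principal `p × p` minors
(equal to `1` for `p = 0`). -/
noncomputable def pTrace {n : ℕ} (p : ℕ) (S : Matrix (Fin n) (Fin n) ℝ) : ℝ :=
  ∑ s ∈ Finset.powersetCard p (Finset.univ : Finset (Fin n)),
    (S.submatrix (fun i : s => (i : Fin n)) (fun j : s => (j : Fin n))).det

/-- `S` is `m`-positive: it is symmetric and its `p`-traces, `p = 1, …, m`, are positive. -/
def IsPositive {n : ℕ} (m : ℕ) (S : Matrix (Fin n) (Fin n) ℝ) : Prop :=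
  S.IsSymm ∧ ∀ p : ℕ, 1 ≤ p → p ≤ m → 0 < pTrace p S

/-- The Hesse matrix of `v` at `x`: the entry `(i, j)` is `∂ⱼ (∂ᵢ v) (x)`. -/
noncomputable def hessian {n : ℕ} (v : EuclideanSpace ℝ (Fin n) → ℝ)
    (x : EuclideanSpace ℝ (Fin n)) : Matrix (Fin n) (Fin n) ℝ :=
  Matrix.of fun i j => fderiv ℝ (gradient v) x (EuclideanSpace.single j 1) i

/-- The stationary operator `T_m[v] = T_m(v_xx)`. -/
noncomputable def stationaryOp {n : ℕ} (m : ℕ) (v : EuclideanSpace ℝ (Fin n) → ℝ)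
    (x : EuclideanSpace ℝ (Fin n)) : ℝ :=
  pTrace m (hessian v x)

/-- The evolution operator `E_m[u] = -u_t T_{m-1}(u_xx) + T_m(u_xx)`, for `1 ≤ m`. -/
noncomputable def evolutionOp {n : ℕ} (m : ℕ) (u : EuclideanSpace ℝ (Fin n) → ℝ → ℝ)
    (x : EuclideanSpace ℝ (Fin n)) (t : ℝ) : ℝ :=
  -(deriv (fun s => u x s) t) * pTrace (m - 1) (hessian (fun y => u y t) x)
    + pTrace m (hessian (fun y => u y t) x)

/-- `v ∈ C²(Ω̄)` with first and second derivatives `vx`, `vxx`: they are the derivatives of `v`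
in the open set `Ω`, and `v`, `vx`, `vxx` are continuous up to the boundary. -/
structure IsC2With {n : ℕ} (Ω : Set (EuclideanSpace ℝ (Fin n)))
    (v : EuclideanSpace ℝ (Fin n) → ℝ)
    (vx : EuclideanSpace ℝ (Fin n) → EuclideanSpace ℝ (Fin n))
    (vxx : EuclideanSpace ℝ (Fin n) → Matrix (Fin n) (Fin n) ℝ) : Prop where
  continuousOn : ContinuousOn v (closure Ω)
  continuousOn_vx : ContinuousOn vx (closure Ω)
  continuousOn_vxx : ContinuousOn vxx (closure Ω)
  hasGradientAt : ∀ x ∈ Ω, HasGradientAt v (vx x) x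
  hasFDerivAt : ∀ x ∈ Ω, HasFDerivAt vx (Matrix.toEuclideanCLM (𝕜 := ℝ) (vxx x)) x

/-- `v` is `m`-admissible in `Ω̄`: it belongs to `C²(Ω̄)` and its Hesse matrix (extended
continuously to `Ω̄`) is `m`-positive at all points of `Ω̄`. -/
def IsAdmissible {n : ℕ} (m : ℕ) (Ω : Set (EuclideanSpace ℝ (Fin n)))
    (v : EuclideanSpace ℝ (Fin n) → ℝ) : Prop :=
  ∃ vx vxx, IsC2With Ω v vx vxx ∧ ∀ x ∈ closure Ω, IsPositive m (vxx x)

/-- `u ∈ C^{2,1}(Ω̄ × [0, ∞))`: the derivatives `u_t`, `u_x`, `u_xx` exist in `Ω × [0, ∞)`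
(`u_t` being one-sided at `t = 0`), and together with `u` they are continuous up to
`Ω̄ × [0, ∞)`. -/
def IsC21 {n : ℕ} (Ω : Set (EuclideanSpace ℝ (Fin n)))
    (u : EuclideanSpace ℝ (Fin n) → ℝ → ℝ) : Prop :=
  ∃ (ut : EuclideanSpace ℝ (Fin n) → ℝ → ℝ)
    (ux : EuclideanSpace ℝ (Fin n) → ℝ → EuclideanSpace ℝ (Fin n))
    (uxx : EuclideanSpace ℝ (Fin n) → ℝ → Matrix (Fin n) (Fin n) ℝ),
    ContinuousOn (Function.uncurry u) (closure Ω ×ˢ Set.Ici 0) ∧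
    ContinuousOn (Function.uncurry ut) (closure Ω ×ˢ Set.Ici 0) ∧
    ContinuousOn (Function.uncurry ux) (closure Ω ×ˢ Set.Ici 0) ∧
    ContinuousOn (Function.uncurry uxx) (closure Ω ×ˢ Set.Ici 0) ∧
    ∀ x ∈ Ω, ∀ t : ℝ, 0 ≤ t →
      HasDerivWithinAt (fun s => u x s) (ut x t) (Set.Ici 0) t ∧
      HasGradientAt (fun y => u y t) (ux x t) x ∧
      HasFDerivAt (fun y => ux y t) (Matrix.toEuclideanCLM (𝕜 := ℝ) (uxx x t)) x

/-- The parabolic boundary `(Ω × {0}) ∪ (∂Ω × [0, ∞))` of `Ω × (0, ∞)`. -/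
def parabolicBoundary {n : ℕ} (Ω : Set (EuclideanSpace ℝ (Fin n))) :
    Set (EuclideanSpace ℝ (Fin n) × ℝ) :=
  (Ω ×ˢ {0}) ∪ (frontier Ω ×ˢ Set.Ici 0)

end MHessian

/-! The evolution operator is the `m`-trace of the block matrix with diagonal blocks `-u_t` and
`u_xx`, so it is governed by the Gårding cones of elementary symmetric functions. Newton's
inequality `e_k e_{k+2} ≤ e_{k+1}²` shows that deleting one eigenvalue costs at most one order of
positivity. Hence on the cone the `m`-trace increases with `-u_t` and with `u_xx`
(`BlockPositive.blockTrace_le`). It also makes the cone relatively open and closed where the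
`m`-trace is positive. Since `Ω × [0, ∞)` is connected and the block matrix lies in the cone at
`(x₀, 0)`, it lies there everywhere (`blockPositive_of_evolution`).

Convergence is then a comparison argument (`eventually_barrier_bound`). From a late time `T` on, `u`
is trapped between `(1 + ε)U - (εK + δ) - g` and `(1 - ε)U + (εK + δ) + g`, where `|U| ≤ K` and `g =
C exp(-μ(t - T))`. By homogeneity the factors `1 ± ε` shift `T_m(U_xx)` by at least `εc`, where `c`
is a positive lower bound of `T_m(U_xx)`. This margin absorbs both the error `f - F` and the term
coming from `g'`, so the minimum principle `nonneg_of_parabolic` applies. As `t → ∞` the term `g`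
dies out, and `ε`, `δ` are arbitrarily small. -/

/-! ### Real-rooted polynomials -/

open Polynomial in
/-- **Laguerre's inequality** for products of real linear factors. -/
theorem Multiset.laguerre_inequality (s : Multiset ℝ) (x : ℝ) :
    (s.map fun a => X - C a).prod.eval x *
        (derivative (derivative (s.map fun a => X - C a).prod)).eval x ≤
      ((derivative (s.map fun a => X - C a).prod).eval x) ^ 2 := by
  induction s using Multiset.induction_on with
  | empty => simp
  | cons a s ih =>
    rw [Multiset.map_cons, Multiset.prod_cons]
    generalize (s.map fun a => X - C a).prod = Q at ih ⊢
    simp only [derivative_mul, derivative_add, derivative_sub, derivative_X, derivative_C,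
      eval_mul, eval_add, eval_sub, eval_X, eval_C, sub_zero, one_mul]
    -- For `P = (X - a)Q` one has `P'² - P P'' = Q² + (x - a)² (Q'² - Q Q'')`.
    nlinarith [sq_nonneg (Q.eval x), mul_le_mul_of_nonneg_left ih (sq_nonneg (x - a))]

open Polynomial in
theorem Polynomial.Splits.laguerre_inequality {p : ℝ[X]} (hp : p.Splits) (x : ℝ) :
    p.eval x * (derivative (derivative p)).eval x ≤ ((derivative p).eval x) ^ 2 := by
  have h := Multiset.laguerre_inequality p.roots x
  have hc := mul_le_mul_of_nonneg_left h (sq_nonneg p.leadingCoeff)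
  rw [hp.eq_prod_roots]
  generalize (p.roots.map fun a => X - C a).prod = Q at hc ⊢
  simp only [derivative_C_mul, eval_C_mul]
  linarith

-- Rolle's theorem: differentiation loses at most one real root, counted with multiplicity, and the
-- degree drops as well.
open Polynomial in
theorem Polynomial.Splits.derivative_real {p : ℝ[X]} (hp : p.Splits) :
    (derivative p).Splits := by
  rw [splits_iff_card_roots] at hp ⊢
  have h1 := card_roots_le_derivative p
  have h2 := (derivative p).card_roots'
  have h3 := natDegree_derivative_le p
  rcases Nat.eq_zero_or_pos p.natDegree with h0 | h0
  · omega
  · omega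

/-! ### Newton's inequality and the Gårding cone of a multiset -/

namespace Multiset

theorem esymm_zero' {R : Type*} [CommSemiring R] (s : Multiset R) : s.esymm 0 = 1 := by
  simp [esymm]

theorem esymm_cons_succ {R : Type*} [CommSemiring R] (a : R) (s : Multiset R) (k : ℕ) :
    (a ::ₘ s).esymm (k + 1) = s.esymm (k + 1) + a * s.esymm k := by
  simp [esymm, powersetCard_cons, map_map, sum_map_mul_left]

theorem esymm_eq_zero_of_card_lt {R : Type*} [CommSemiring R] {s : Multiset R} {k : ℕ}
    (h : card s < k) : s.esymm k = 0 := by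
  simp [esymm, powersetCard_eq_empty k h]

open Polynomial in
theorem coeff_prod_one_add_C_mul_X {R : Type*} [CommSemiring R] (s : Multiset R) (k : ℕ) :
    (s.map fun a => 1 + C a * X).prod.coeff k = s.esymm k := by
  induction s using Multiset.induction_on generalizing k with
  | empty =>
    cases k with
    | zero => simp [esymm]
    | succ k => rw [esymm_eq_zero_of_card_lt (by simp)]; simp [coeff_one]
  | cons a s ih =>
    rw [map_cons, prod_cons, add_mul, one_mul, mul_assoc, coeff_add, coeff_C_mul]
    cases k with
    | zero => simp [ih, esymm_zero']
    | succ k => rw [coeff_X_mul, ih, ih, esymm_cons_succ]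

open Polynomial in
/-- **Newton's inequality** (with the constant `1`) for elementary symmetric functions. -/
theorem newton_inequality (s : Multiset ℝ) (k : ℕ) :
    s.esymm k * s.esymm (k + 2) ≤ s.esymm (k + 1) ^ 2 := by
  rcases lt_or_ge (card s) (k + 2) with h | h
  · rw [esymm_eq_zero_of_card_lt h]; nlinarith [sq_nonneg (s.esymm (k + 1))]
  obtain ⟨r, hr⟩ := Nat.exists_eq_add_of_le h
  -- Differentiating `r = card s - (k + 2)` times brings `e_{k+2}`, `e_{k+1}`, `e_k` into the lowest
  -- three coefficients. Laguerre at `0` then gives the sharper factor `(r + 1) / (r + 2)`.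
  set p : ℝ[X] := (s.map fun a => X + C a).prod with hp
  have hs : ∀ i, ((derivative^[i]) p).Splits := by
    intro i
    induction i with
    | zero =>
      refine Splits.multisetProd ?_
      intro q hq
      obtain ⟨a, -, rfl⟩ := Multiset.mem_map.1 hq
      exact Splits.X_add_C a
    | succ i ih => rw [Function.iterate_succ_apply']; exact ih.derivative_real
  have hv : ∀ i ≤ card s, ((derivative^[i]) p).eval 0 = i.factorial * s.esymm (card s - i) := by
    intro i hi
    rw [← coeff_zero_eq_eval_zero, coeff_iterate_derivative, zero_add, Nat.descFactorial_self,
      nsmul_eq_mul, hp, prod_X_add_C_coeff s hi]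
  have hl := (hs r).laguerre_inequality 0
  rw [← Function.iterate_succ_apply' derivative, ← Function.iterate_succ_apply' derivative,
    hv _ (by omega), hv _ (by omega), hv _ (by omega), show card s - r = k + 2 by omega,
    show card s - r.succ = k + 1 by omega, show card s - r.succ.succ = k by omega,
    Nat.factorial_succ, Nat.factorial_succ] at hl
  push_cast at hl
  have hf : (0 : ℝ) < r.factorial := by positivity
  have hl' : (r + 1 + 1 : ℝ) * (s.esymm k * s.esymm (k + 2)) ≤ (r + 1) * s.esymm (k + 1) ^ 2 := by
    have hpos : (0 : ℝ) < (r + 1) * (r.factorial : ℝ) ^ 2 := by positivity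
    refine le_of_mul_le_mul_left ?_ hpos
    linarith
  have hr0 : (0 : ℝ) ≤ r := by positivity
  nlinarith [sq_nonneg (s.esymm (k + 1))]

/-- The multiset `s` lies in the `m`-th Gårding cone. -/
def IsGarding (m : ℕ) (s : Multiset ℝ) : Prop := ∀ p ≤ m, 0 < s.esymm p

/-- The source of monotonicity, since `e_k(s)` is the derivative of `e_{k+1}(a ::ₘ s)` in `a`. If
`e_{k+1}(s) ≤ 0` while `e_k(s) > 0`, eliminating `a` from the two positivity conditions on `a ::ₘ s`
gives `e_k e_{k+2} > e_{k+1}²`, against Newton. -/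
theorem IsGarding.of_cons {m : ℕ} {a : ℝ} {s : Multiset ℝ} (h : (a ::ₘ s).IsGarding (m + 1)) :
    s.IsGarding m := by
  intro p
  induction p with
  | zero => simp [esymm_zero']
  | succ k ih =>
    intro hk
    have h0 := ih (by omega)
    have h1 := h (k + 1) (by omega)
    have h2 := h (k + 2) (by omega)
    rw [esymm_cons_succ] at h1 h2
    have hN := newton_inequality s k
    by_contra! hc
    nlinarith [mul_pos h0 h2, mul_nonneg h1.le (neg_nonneg.2 hc)]

/-- By Newton the ratios `e_{p+1} / e_p` decrease in `p`. This is a closed condition that prevents a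
lower trace from vanishing before the last one. -/
theorem IsGarding.esymm_succ_le {m p : ℕ} {s : Multiset ℝ} (h : s.IsGarding m) (hp : p < m) :
    s.esymm (p + 1) ≤ s.esymm 1 * s.esymm p := by
  induction p with
  | zero => simp [esymm_zero']
  | succ k ih =>
    have h0 := h k (by omega)
    have h1 := h (k + 1) (by omega)
    have hN := newton_inequality s k
    refine le_of_mul_le_mul_left ?_ h0
    nlinarith [mul_le_mul_of_nonneg_left (ih (by omega)) h1.le]

/-- Positivity descends from the top order: multiplying `e_{k+2}(a ::ₘ s) > 0` by `e_k(s)` and using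
Newton gives `e_{k+1}(s) e_{k+1}(a ::ₘ s) > 0`. -/
theorem IsGarding.cons {m : ℕ} {a : ℝ} {s : Multiset ℝ} (h : s.IsGarding m)
    (hm : 0 < (a ::ₘ s).esymm (m + 1)) : (a ::ₘ s).IsGarding (m + 1) := by
  have key : ∀ j p, p + j = m + 1 → 0 < (a ::ₘ s).esymm p := by
    intro j
    induction j with
    | zero => intro p hp; rw [show p = m + 1 by omega]; exact hm
    | succ j ih =>
      intro p hp
      cases p with
      | zero => simp [esymm_zero']
      | succ k =>
        have h2 := ih (k + 2) (by omega)
        rw [esymm_cons_succ] at h2 ⊢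
        have hN := newton_inequality s k
        have h0 := h k (by omega)
        have h1 := h (k + 1) (by omega)
        have : 0 < s.esymm (k + 1) * (s.esymm (k + 1) + a * s.esymm k) := by
          nlinarith [mul_pos h0 h2]
        exact pos_of_mul_pos_right this h1.le
  intro p hp
  exact key (m + 1 - p) p (by omega)

end Multiset

/-! ### Traces under rank-one perturbation and orthogonal conjugation -/

namespace Matrix

/-- The determinant of a rank-one perturbation of a diagonal matrix. -/
theorem det_diagonal_add_vecMulVec {ι R : Type*} [Fintype ι] [DecidableEq ι] [CommRing R]
    (d u v : ι → R) :
    (diagonal d + vecMulVec u v).det =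
      ∏ i, d i + ∑ i, u i * v i * ∏ j ∈ Finset.univ.erase i, d j := by
  -- The vector `v` is switched on one coordinate at a time, so each step changes a single column.
  have key : ∀ s : Finset ι,
      (diagonal d + vecMulVec u (fun j => if j ∈ s then v j else 0)).det =
        ∏ i, d i + ∑ i ∈ s, u i * v i * ∏ j ∈ Finset.univ.erase i, d j := by
    intro s
    induction s using Finset.induction_on with
    | empty =>
      have : vecMulVec u (fun j => if j ∈ (∅ : Finset ι) then v j else 0) = 0 := by
        ext; simp [vecMulVec_apply]
      rw [this, add_zero, det_diagonal, Finset.sum_empty, add_zero]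
    | insert k s hk ih =>
      set M := diagonal d + vecMulVec u (fun j => if j ∈ s then v j else 0) with hM
      have h1 : diagonal d + vecMulVec u (fun j => if j ∈ insert k s then v j else 0) =
          M.updateCol k ((fun i => M i k) + v k • u) := by
        ext i j
        by_cases hj : j = k
        · subst hj
          simp [hM, vecMulVec_apply, hk, mul_comm]
        · simp [hM, vecMulVec_apply, hj]
      -- Once column `k` is `u`, multiples of it clear the rank-one part from all other columns.
      have h2 : (M.updateCol k u).det = ((diagonal d).updateCol k u).det := by
        rw [← det_transpose, ← det_transpose ((diagonal d).updateCol k u)]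
        refine det_eq_of_forall_row_eq_smul_add_const (fun j => if j ∈ s then v j else 0) k
          (by simp [hk]) ?_
        intro i j
        by_cases hi : i = k
        · subst hi; simp [hk]
        · simp [hM, hi, vecMulVec_apply, mul_comm]
      rw [h1, det_updateCol_add, det_updateCol_smul, updateCol_eq_self, ih, h2, ← cramer_apply,
        cramer_eq_adjugate_mulVec, adjugate_diagonal, mulVec_diagonal, Finset.sum_insert hk]
      ring
  simpa using key Finset.univ

end Matrix

namespace MHessian

open Matrix Polynomial

variable {n : ℕ}

theorem pTrace_eq_coeff (p : ℕ) (S : Matrix (Fin n) (Fin n) ℝ) :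
    pTrace p S = (det (1 + (X : ℝ[X]) • S.map C)).coeff p :=
  (coeff_det_one_add_X_smul_eq_sum_minors S p).symm

theorem pTrace_zero (S : Matrix (Fin n) (Fin n) ℝ) : pTrace 0 S = 1 := by
  simp [pTrace]

theorem pTrace_smul (p : ℕ) (c : ℝ) (S : Matrix (Fin n) (Fin n) ℝ) :
    pTrace p (c • S) = c ^ p * pTrace p S := by
  rw [pTrace, pTrace, Finset.mul_sum]
  refine Finset.sum_congr rfl fun s hs => ?_
  rw [submatrix_smul, Pi.smul_apply, Pi.smul_apply, det_smul, Fintype.card_coe,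
    (Finset.mem_powersetCard.1 hs).2]

theorem continuous_pTrace (p : ℕ) :
    Continuous (pTrace p : Matrix (Fin n) (Fin n) ℝ → ℝ) := by
  unfold pTrace
  refine continuous_finsetSum _ fun s _ => ?_
  exact (continuous_id.matrix_submatrix _ _).matrix_det

/-- In `det (1 + X S)` the rank-one part carries exactly one factor `X`, so its contribution to the
coefficient of `X ^ (k + 1)` has order `k` in the spectrum with one eigenvalue deleted. -/
theorem pTrace_diagonal_add_vecMulVec (k : ℕ) (d w : Fin n → ℝ) :
    pTrace (k + 1) (diagonal d + vecMulVec w w) =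
      (Finset.univ.val.map d).esymm (k + 1) +
        ∑ i, w i ^ 2 * ((Finset.univ.erase i).val.map d).esymm k := by
  have h : (1 : Matrix (Fin n) (Fin n) ℝ[X]) + (X : ℝ[X]) • (diagonal d + vecMulVec w w).map C =
      diagonal (fun i => 1 + C (d i) * X) +
        vecMulVec (fun i => C (w i) * X) (fun i => C (w i)) := by
    ext1 i j
    by_cases hij : i = j
    · subst hij; simp [vecMulVec_apply]; ring
    · simp [vecMulVec_apply, hij]; ring
  rw [pTrace_eq_coeff, h, det_diagonal_add_vecMulVec, coeff_add, finsetSum_coeff,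
    ← Multiset.coeff_prod_one_add_C_mul_X, Multiset.map_map]
  congr 1
  refine Finset.sum_congr rfl fun i _ => ?_
  rw [← Multiset.coeff_prod_one_add_C_mul_X, Multiset.map_map,
    show C (w i) * X * C (w i) * ∏ j ∈ Finset.univ.erase i, (1 + C (d j) * X) =
      C (w i ^ 2) * (X * ∏ j ∈ Finset.univ.erase i, (1 + C (d j) * X)) by
      rw [C_pow]; ring, coeff_C_mul, coeff_X_mul]
  rfl

theorem pTrace_conj (p : ℕ) {V W : Matrix (Fin n) (Fin n) ℝ} (h : W * V = 1)
    (S : Matrix (Fin n) (Fin n) ℝ) : pTrace p (V * S * W) = pTrace p S := by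
  have h' : V * W = 1 := mul_eq_one_comm.1 h
  have hm : ∀ A B : Matrix (Fin n) (Fin n) ℝ, (A * B).map C = A.map C * B.map C := fun A B =>
    Matrix.map_mul
  have h1 : V.map C * W.map C = (1 : Matrix (Fin n) (Fin n) ℝ[X]) := by
    rw [← hm, h']; exact Matrix.map_one _ (by simp) (by simp)
  have h2 : (1 : Matrix (Fin n) (Fin n) ℝ[X]) + (X : ℝ[X]) • (V * S * W).map C =
      V.map C * (1 + (X : ℝ[X]) • S.map C) * W.map C := by
    rw [hm, hm, Matrix.mul_add, Matrix.add_mul, Matrix.mul_one, h1, Matrix.mul_smul,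
      Matrix.smul_mul]
  have h3 : (V.map C).det * (W.map C).det = (1 : ℝ[X]) := by rw [← det_mul, h1, det_one]
  rw [pTrace_eq_coeff, pTrace_eq_coeff, h2, det_mul, det_mul, mul_right_comm, h3, one_mul]

theorem exists_orthogonal_diagonalization {S : Matrix (Fin n) (Fin n) ℝ} (hS : S.IsSymm) :
    ∃ (V : Matrix (Fin n) (Fin n) ℝ) (d : Fin n → ℝ), V * Vᵀ = 1 ∧ S = V * diagonal d * Vᵀ := by
  have hH : S.IsHermitian := by
    rw [IsHermitian, conjTranspose_eq_transpose_of_trivial]; exact hS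
  refine ⟨hH.eigenvectorUnitary, hH.eigenvalues, ?_, ?_⟩
  · rw [← conjTranspose_eq_transpose_of_trivial]
    exact Unitary.coe_mul_star_self hH.eigenvectorUnitary
  · have := hH.spectral_theorem
    rw [Unitary.conjStarAlgAut_apply] at this
    rw [← conjTranspose_eq_transpose_of_trivial]
    exact this

/-- The eigenvalues of a symmetric matrix `S` and their deletions determine the traces of `S`
and of its rank-one perturbations. -/
theorem exists_pTrace_add_vecMulVec {S : Matrix (Fin n) (Fin n) ℝ} (hS : S.IsSymm)
    (w : Fin n → ℝ) :
    ∃ d z : Fin n → ℝ, (∀ p, pTrace p S = (Finset.univ.val.map d).esymm p) ∧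
      ∀ k, pTrace (k + 1) (S + vecMulVec w w) = (Finset.univ.val.map d).esymm (k + 1) +
        ∑ i, z i ^ 2 * ((Finset.univ.erase i).val.map d).esymm k := by
  obtain ⟨V, d, hV, rfl⟩ := exists_orthogonal_diagonalization hS
  have hV' : Vᵀ * V = 1 := mul_eq_one_comm.1 hV
  refine ⟨d, Vᵀ *ᵥ w, fun p => ?_, fun k => ?_⟩
  · rw [pTrace_conj p hV']
    cases p with
    | zero => rw [pTrace_zero, Multiset.esymm_zero']
    | succ k => simpa using pTrace_diagonal_add_vecMulVec k d 0
  · rw [← pTrace_diagonal_add_vecMulVec, ← pTrace_conj (k + 1) hV' (diagonal d + _)]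
    congr 1
    rw [Matrix.mul_add, Matrix.add_mul, mul_vecMulVec, vecMulVec_mul, vecMul_transpose,
      mulVec_mulVec, hV, one_mulVec]

theorem exists_esymm_eq_pTrace {S : Matrix (Fin n) (Fin n) ℝ} (hS : S.IsSymm) :
    ∃ s : Multiset ℝ, ∀ p, pTrace p S = s.esymm p :=
  let ⟨_, _, hd, _⟩ := exists_pTrace_add_vecMulVec hS 0
  ⟨_, hd⟩

/-! ### Block traces and their monotonicity on the cone -/

/-- The `p`-trace of the block matrix with diagonal blocks `a` and `S`. -/
noncomputable def blockTrace (p : ℕ) (a : ℝ) (S : Matrix (Fin n) (Fin n) ℝ) : ℝ :=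
  match p with
  | 0 => 1
  | k + 1 => a * pTrace k S + pTrace (k + 1) S

theorem blockTrace_eq_esymm {S : Matrix (Fin n) (Fin n) ℝ} {s : Multiset ℝ}
    (h : ∀ p, pTrace p S = s.esymm p) (a : ℝ) (p : ℕ) :
    blockTrace p a S = (a ::ₘ s).esymm p := by
  cases p with
  | zero => simp [blockTrace, Multiset.esymm_zero']
  | succ k => rw [blockTrace, Multiset.esymm_cons_succ, h, h, add_comm]

theorem continuous_blockTrace (p : ℕ) :
    Continuous fun z : ℝ × Matrix (Fin n) (Fin n) ℝ => blockTrace p z.1 z.2 := by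
  cases p with
  | zero => exact continuous_const
  | succ k =>
    exact (continuous_fst.mul ((continuous_pTrace k).comp continuous_snd)).add
      ((continuous_pTrace (k + 1)).comp continuous_snd)

/-- The block matrix with diagonal blocks `a` and `S` lies in the `m`-th Gårding cone. -/
def BlockPositive (m : ℕ) (a : ℝ) (S : Matrix (Fin n) (Fin n) ℝ) : Prop :=
  ∀ p ≤ m, 0 < blockTrace p a S

theorem BlockPositive.of_isPositive {m : ℕ} {a : ℝ} {S : Matrix (Fin n) (Fin n) ℝ}
    (hS : IsPositive m S) (h : 0 < blockTrace (m + 1) a S) : BlockPositive (m + 1) a S := by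
  obtain ⟨s, hs⟩ := exists_esymm_eq_pTrace hS.1
  have hG : s.IsGarding m := by
    intro p hp
    rcases Nat.eq_zero_or_pos p with rfl | h0
    · simp [Multiset.esymm_zero']
    · rw [← hs]; exact hS.2 p h0 hp
  rw [blockTrace_eq_esymm hs] at h
  intro p hp
  rw [blockTrace_eq_esymm hs]
  exact hG.cons h p hp

theorem BlockPositive.succ_le {m p : ℕ} {a : ℝ} {S : Matrix (Fin n) (Fin n) ℝ}
    (hS : S.IsSymm) (h : BlockPositive m a S) (hp : p < m) :
    blockTrace (p + 1) a S ≤ blockTrace 1 a S * blockTrace p a S := by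
  obtain ⟨s, hs⟩ := exists_esymm_eq_pTrace hS
  simp only [BlockPositive, blockTrace_eq_esymm hs] at h ⊢
  exact Multiset.IsGarding.esymm_succ_le h hp

/-- A zero trace of order `p < m` would force the next one to be nonpositive; descending from order
`m` rules this out. -/
theorem BlockPositive.of_nonneg {m : ℕ} {a : ℝ} {S : Matrix (Fin n) (Fin n) ℝ}
    (h0 : ∀ p ≤ m, 0 ≤ blockTrace p a S)
    (h1 : ∀ p < m, blockTrace (p + 1) a S ≤ blockTrace 1 a S * blockTrace p a S)
    (hm : 0 < blockTrace m a S) : BlockPositive m a S := by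
  have key : ∀ j p, p + j = m → 0 < blockTrace p a S := by
    intro j
    induction j with
    | zero => rintro p rfl; exact hm
    | succ j ih =>
      intro p hp
      refine (h0 p (by omega)).lt_of_ne' fun hz => ?_
      have h2 := h1 p (by omega)
      rw [hz, mul_zero] at h2
      exact h2.not_gt (ih (p + 1) (by omega))
  exact fun p hp => key (m - p) p (by omega)

theorem BlockPositive.add_left {m : ℕ} {a b : ℝ} {S : Matrix (Fin n) (Fin n) ℝ}
    (hS : S.IsSymm) (h : BlockPositive m a S) (hab : a ≤ b) {p : ℕ} (hp : p ≤ m) :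
    blockTrace p a S ≤ blockTrace p b S := by
  cases p with
  | zero => exact le_rfl
  | succ k =>
    obtain ⟨s, hs⟩ := exists_esymm_eq_pTrace hS
    simp only [BlockPositive, blockTrace_eq_esymm hs] at h
    have := Multiset.IsGarding.of_cons (m := k) (fun q hq => h q (hq.trans hp)) k le_rfl
    simp only [blockTrace, hs]
    nlinarith

/-- In an eigenbasis of `S` the increment is a combination, with weights `z i ^ 2`, of symmetric
functions of the block spectrum without `d i`; these are positive by `IsGarding.of_cons`. -/
theorem BlockPositive.add_vecMulVec {m : ℕ} {a : ℝ} {S : Matrix (Fin n) (Fin n) ℝ}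
    (hS : S.IsSymm) (h : BlockPositive m a S) (w : Fin n → ℝ) {p : ℕ} (hp : p ≤ m) :
    blockTrace p a S ≤ blockTrace p a (S + vecMulVec w w) := by
  obtain ⟨d, z, hd, hz⟩ := exists_pTrace_add_vecMulVec hS w
  have hcons : ∀ i, d i ::ₘ (Finset.univ.erase i).val.map d = Finset.univ.val.map d := by
    intro i
    rw [← Multiset.map_cons, Finset.erase_val, Multiset.cons_erase (Finset.mem_univ i)]
  cases p with
  | zero => exact le_rfl
  | succ k =>
    have hpos : ∀ i, 0 ≤ (a ::ₘ (Finset.univ.erase i).val.map d).esymm k := by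
      intro i
      refine (Multiset.IsGarding.of_cons (a := d i) (m := k) ?_ k le_rfl).le
      intro q hq
      rw [Multiset.cons_swap, hcons, ← blockTrace_eq_esymm hd]
      exact h q (hq.trans hp)
    cases k with
    | zero =>
      simp only [blockTrace, pTrace_zero, hd, hz, Multiset.esymm_zero']
      have : 0 ≤ ∑ i, z i ^ 2 * (1 : ℝ) := Finset.sum_nonneg fun i _ => by positivity
      linarith
    | succ k =>
      have hsum : 0 ≤ ∑ i, z i ^ 2 * (a ::ₘ (Finset.univ.erase i).val.map d).esymm (k + 1) :=
        Finset.sum_nonneg fun i _ => mul_nonneg (sq_nonneg _) (hpos i)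
      simp only [Multiset.esymm_cons_succ, mul_add, Finset.sum_add_distrib,
        mul_left_comm _ a, ← Finset.mul_sum] at hsum
      simp only [blockTrace, hd, hz]
      linarith

theorem BlockPositive.add_posSemidef {m : ℕ} {a : ℝ} {S P : Matrix (Fin n) (Fin n) ℝ}
    (hS : S.IsSymm) (h : BlockPositive m a S) (hP : P.PosSemidef) {p : ℕ} (hp : p ≤ m) :
    blockTrace p a S ≤ blockTrace p a (S + P) := by
  obtain ⟨r, B, rfl⟩ := posSemidef_iff_eq_sum_vecMulVec.1 hP
  simp only [star_trivial]
  -- All orders `p ≤ m` are carried along, so that the matrix stays in the cone after each rank-one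
  -- summand.
  have key : ∀ s : Finset (Fin r), (S + ∑ i ∈ s, vecMulVec (B i) (B i)).IsSymm ∧
      ∀ p ≤ m, blockTrace p a S ≤ blockTrace p a (S + ∑ i ∈ s, vecMulVec (B i) (B i)) := by
    intro s
    induction s using Finset.induction_on with
    | empty => simpa using hS
    | insert k s hk ih =>
      rw [Finset.sum_insert hk, add_comm (vecMulVec _ _), ← add_assoc]
      refine ⟨ih.1.add (by rw [IsSymm, transpose_vecMulVec]), fun p hp => (ih.2 p hp).trans ?_⟩
      exact BlockPositive.add_vecMulVec (m := m) ih.1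
        (fun q hq => (h q hq).trans_le (ih.2 q hq)) _ hp
  exact (key Finset.univ).2 p hp

/-- Monotonicity of the block traces on the Gårding cone. -/
theorem BlockPositive.blockTrace_le {m : ℕ} {a b : ℝ} {S S' : Matrix (Fin n) (Fin n) ℝ}
    (hS : S.IsSymm) (h : BlockPositive m a S) (hab : a ≤ b) (hP : (S' - S).PosSemidef) :
    blockTrace m a S ≤ blockTrace m b S' := by
  refine (h.add_left hS hab le_rfl).trans ?_
  have hb : BlockPositive m b S := fun q hq => (h q hq).trans_le (h.add_left hS hab hq)
  simpa using hb.add_posSemidef hS hP le_rfl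

end MHessian

/-! ### Second-order conditions, minimum principle, connectedness -/

namespace MHessian

open Matrix Filter Topology Set

section SecondOrder

variable {n : ℕ} {v : EuclideanSpace ℝ (Fin n) → ℝ}
  {vx : EuclideanSpace ℝ (Fin n) → EuclideanSpace ℝ (Fin n)}
  {H : Matrix (Fin n) (Fin n) ℝ} {x : EuclideanSpace ℝ (Fin n)}

theorem hessian_eq_of_hasFDerivAt (hv : ∀ᶠ y in 𝓝 x, HasGradientAt v (vx y) y)
    (hx : HasFDerivAt vx (Matrix.toEuclideanCLM (𝕜 := ℝ) H) x) : hessian v x = H := by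
  have h1 : gradient v =ᶠ[𝓝 x] vx := hv.mono fun y hy => hy.gradient
  ext i j
  rw [hessian, of_apply, h1.fderiv_eq, hx.fderiv]
  simp [Matrix.ofLp_toEuclideanCLM]

theorem inner_toEuclideanCLM_single (H : Matrix (Fin n) (Fin n) ℝ) (i j : Fin n) :
    inner ℝ (Matrix.toEuclideanCLM (𝕜 := ℝ) H (EuclideanSpace.single i 1))
      (EuclideanSpace.single j (1 : ℝ)) = H j i := by
  rw [EuclideanSpace.inner_single_right]
  simp [Matrix.ofLp_toEuclideanCLM]

theorem isSymm_of_hasFDerivAt (hv : ∀ᶠ y in 𝓝 x, HasGradientAt v (vx y) y)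
    (hx : HasFDerivAt vx (Matrix.toEuclideanCLM (𝕜 := ℝ) H) x) : H.IsSymm := by
  have hd : HasFDerivAt (fun y => InnerProductSpace.toDual ℝ (EuclideanSpace ℝ (Fin n)) (vx y))
      ((InnerProductSpace.toDual ℝ
        (EuclideanSpace ℝ (Fin n))).toContinuousLinearEquiv.toContinuousLinearMap.comp
          (Matrix.toEuclideanCLM (𝕜 := ℝ) H)) x :=
    ((InnerProductSpace.toDual ℝ
        (EuclideanSpace ℝ (Fin n))).toContinuousLinearEquiv.toContinuousLinearMap).hasFDerivAt.comp
      x hx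
  have hs := second_derivative_symmetric_of_eventually (hv.mono fun y hy => hy.hasFDerivAt) hd
  ext i j
  have := hs (EuclideanSpace.single i 1) (EuclideanSpace.single j 1)
  simp only [ContinuousLinearMap.comp_apply, ContinuousLinearEquiv.coe_coe,
    LinearIsometryEquiv.coe_toContinuousLinearEquiv, InnerProductSpace.toDual_apply_apply,
    inner_toEuclideanCLM_single] at this
  simpa using this

/-- The Hesse matrix is positive semidefinite at a local minimum. -/
theorem posSemidef_of_isLocalMin (hv : ∀ᶠ y in 𝓝 x, HasGradientAt v (vx y) y)
    (hx : HasFDerivAt vx (Matrix.toEuclideanCLM (𝕜 := ℝ) H) x) (hmin : IsLocalMin v x) :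
    H.PosSemidef := by
  have hsymm := isSymm_of_hasFDerivAt hv hx
  refine PosSemidef.of_dotProduct_mulVec_nonneg
    (by rw [IsHermitian, conjTranspose_eq_transpose_of_trivial]; exact hsymm) fun ξ => ?_
  rw [star_trivial]
  by_contra! hneg
  set e : EuclideanSpace ℝ (Fin n) := WithLp.toLp 2 ξ with he
  set ℓ : ℝ → EuclideanSpace ℝ (Fin n) := fun s => x + s • e with hℓ
  have hℓd : ∀ s, HasDerivAt ℓ e s := fun s => by
    have := ((hasDerivAt_id s).smul_const e).const_add x
    rwa [one_smul] at this
  have hℓ0 : ℓ 0 = x := by simp [hℓ]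
  have hℓt : Tendsto ℓ (𝓝 0) (𝓝 x) := by
    have := (hℓd 0).continuousAt.tendsto
    rwa [hℓ0] at this
  have hd1 : ∀ᶠ s in 𝓝 (0 : ℝ), HasDerivAt (v ∘ ℓ) (inner ℝ (vx (ℓ s)) e) s := by
    filter_upwards [hℓt.eventually hv] with s hs
    have := hs.hasFDerivAt.comp_hasDerivAt s (hℓd s)
    simpa using this
  have hd2 : HasDerivAt (fun s => inner ℝ (vx (ℓ s)) e) (ξ ⬝ᵥ (H *ᵥ ξ)) 0 := by
    have hx' : HasFDerivAt vx (Matrix.toEuclideanCLM (𝕜 := ℝ) H) (ℓ 0) := by rwa [hℓ0]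
    have h1 : HasDerivAt (fun s => vx (ℓ s)) (Matrix.toEuclideanCLM (𝕜 := ℝ) H e) 0 :=
      hx'.comp_hasDerivAt (0 : ℝ) (hℓd 0)
    have h2 := h1.inner ℝ (hasDerivAt_const (0 : ℝ) e)
    have hval : inner ℝ (vx (ℓ 0)) (0 : EuclideanSpace ℝ (Fin n)) +
        inner ℝ (Matrix.toEuclideanCLM (𝕜 := ℝ) H e) e = ξ ⬝ᵥ (H *ᵥ ξ) := by
      rw [inner_zero_right, zero_add]
      simp [PiLp.inner_apply, dotProduct, he]
    rw [← hval]
    exact h2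
  have hmin' : IsLocalMin (v ∘ ℓ) 0 := by
    have : ∀ᶠ s in 𝓝 (0 : ℝ), v x ≤ v (ℓ s) := hℓt.eventually hmin
    filter_upwards [this] with s hs
    simpa [hℓ0] using hs
  have hderiv : deriv (v ∘ ℓ) =ᶠ[𝓝 0] fun s => inner ℝ (vx (ℓ s)) e :=
    hd1.mono fun s hs => hs.deriv
  have hdd : deriv (deriv (v ∘ ℓ)) 0 = ξ ⬝ᵥ (H *ᵥ ξ) := by rw [hderiv.deriv_eq, hd2.deriv]
  -- A negative second derivative makes the minimum also a local maximum, so `v ∘ ℓ` is locally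
  -- constant and its second derivative vanishes.
  have hmax : IsLocalMax (v ∘ ℓ) 0 := by
    refine isLocalMax_of_deriv_deriv_neg (by rwa [hdd]) hmin'.deriv_eq_zero ?_
    exact hd1.self_of_nhds.continuousAt
  have hconst : (v ∘ ℓ) =ᶠ[𝓝 0] fun _ => (v ∘ ℓ) 0 := by
    filter_upwards [hmin', hmax] with s h1 h2
    exact le_antisymm h2 h1
  have hz : deriv (v ∘ ℓ) =ᶠ[𝓝 0] fun _ => 0 := by
    have := hconst.deriv
    simpa using this
  rw [hz.deriv_eq, deriv_const] at hdd
  linarith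

end SecondOrder

/-- A one-sided first-order condition: at a minimum over `[T, t]` attained at the right end point
the derivative is nonpositive. -/
theorem deriv_nonpos_of_min_right {g : ℝ → ℝ} {g' T t : ℝ} (hT : T < t) (hg : HasDerivAt g g' t)
    (hmin : ∀ s ∈ Icc T t, g t ≤ g s) : g' ≤ 0 := by
  have h1 : Tendsto (slope g t) (𝓝[<] t) (𝓝 g') :=
    (hasDerivAt_iff_tendsto_slope.1 hg).mono_left (nhdsWithin_mono _ fun s hs => ne_of_lt hs)
  refine le_of_tendsto h1 ?_
  filter_upwards [Ioo_mem_nhdsLT hT] with s hs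
  rw [slope_def_field]
  exact div_nonpos_of_nonneg_of_nonpos (sub_nonneg.2 (hmin s ⟨hs.1.le, hs.2.le⟩))
    (sub_nonpos.2 hs.2.le)

/-- A minimum principle on the cylinder `Ω × (T, ∞)`: a function without interior points at which
`w_t ≤ 0` and `w_xx ≥ 0` attains its minimum on the parabolic boundary. -/
theorem nonneg_of_parabolic {n : ℕ} {Ω : Set (EuclideanSpace ℝ (Fin n))} (hΩ : IsOpen Ω)
    (hb : Bornology.IsBounded Ω) {T : ℝ}
    {w wt : EuclideanSpace ℝ (Fin n) → ℝ → ℝ}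
    {wx : EuclideanSpace ℝ (Fin n) → ℝ → EuclideanSpace ℝ (Fin n)}
    {wxx : EuclideanSpace ℝ (Fin n) → ℝ → Matrix (Fin n) (Fin n) ℝ}
    (hc : ContinuousOn (Function.uncurry w) (closure Ω ×ˢ Ici T))
    (hwt : ∀ x ∈ Ω, ∀ t, T < t → HasDerivAt (w x) (wt x t) t)
    (hwx : ∀ x ∈ Ω, ∀ t, T < t → HasGradientAt (fun y => w y t) (wx x t) x)
    (hwxx : ∀ x ∈ Ω, ∀ t, T < t →
      HasFDerivAt (fun y => wx y t) (Matrix.toEuclideanCLM (𝕜 := ℝ) (wxx x t)) x)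
    (hinit : ∀ x ∈ closure Ω, 0 ≤ w x T)
    (hlat : ∀ x ∈ frontier Ω, ∀ t, T ≤ t → 0 ≤ w x t)
    (hint : ∀ x ∈ Ω, ∀ t, T < t → wt x t ≤ 0 → ¬ (wxx x t).PosSemidef)
    {x : EuclideanSpace ℝ (Fin n)} (hx : x ∈ closure Ω) {t : ℝ} (ht : T ≤ t) : 0 ≤ w x t := by
  have hK : IsCompact (closure Ω ×ˢ Icc T t) := hb.isCompact_closure.prod isCompact_Icc
  have hmem : (x, t) ∈ closure Ω ×ˢ Icc T t := ⟨hx, ht, le_rfl⟩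
  obtain ⟨⟨y, s⟩, ⟨hy, hs⟩, hmin⟩ := hK.exists_isMinOn ⟨_, hmem⟩
    (hc.mono (prod_mono_right Icc_subset_Ici_self))
  simp only at hy hs
  have hle : ∀ z ∈ closure Ω, ∀ r ∈ Icc T t, w y s ≤ w z r := fun z hz r hr =>
    hmin (show (z, r) ∈ closure Ω ×ˢ Icc T t from ⟨hz, hr⟩)
  refine le_trans ?_ (hle x hx t ⟨ht, le_rfl⟩)
  rcases hs.1.eq_or_lt with rfl | hTs
  · exact hinit y hy
  by_cases hyΩ : y ∈ Ω
  · exfalso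
    refine hint y hyΩ s hTs ?_ ?_
    -- The minimum may lie on the top face `s = t`, so only earlier times are compared.
    · exact deriv_nonpos_of_min_right hTs (hwt y hyΩ s hTs) fun r hr =>
        hle y hy r ⟨hr.1, hr.2.trans hs.2⟩
    · refine posSemidef_of_isLocalMin (v := fun y => w y s) (vx := fun y => wx y s) ?_
        (hwxx y hyΩ s hTs) ?_
      · filter_upwards [hΩ.mem_nhds hyΩ] with z hz using hwx z hz s hTs
      · filter_upwards [hΩ.mem_nhds hyΩ] with z hz using hle z (subset_closure hz) s hs
  · exact hlat y ⟨hy, by rwa [hΩ.interior_eq]⟩ s hs.1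

/-- The Gårding cone is relatively closed and open in the set where the last trace is positive. -/
theorem BlockPositive.of_preconnected {n m : ℕ} {Z : Type*} [TopologicalSpace Z]
    [PreconnectedSpace Z] {a : Z → ℝ} {S : Z → Matrix (Fin n) (Fin n) ℝ}
    (ha : Continuous a) (hS : Continuous S) (hsymm : ∀ z, (S z).IsSymm)
    (hpos : ∀ z, 0 < blockTrace m (a z) (S z)) {z₀ : Z} (h₀ : BlockPositive m (a z₀) (S z₀))
    (z : Z) : BlockPositive m (a z) (S z) := by
  have hcont : ∀ p, Continuous fun z => blockTrace p (a z) (S z) := fun p =>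
    (continuous_blockTrace p).comp (ha.prodMk hS)
  have hopen : IsOpen {z | BlockPositive m (a z) (S z)} := by
    have : {z | BlockPositive m (a z) (S z)} =
        ⋂ p ∈ Finset.range (m + 1), {z | 0 < blockTrace p (a z) (S z)} := by
      ext z; simp [BlockPositive]
    rw [this]
    exact isOpen_biInter_finset fun p _ => isOpen_lt continuous_const (hcont p)
  have hclosed : IsClosed {z | BlockPositive m (a z) (S z)} := by
    -- Weak inequalities describe the cone here, because the last trace is positive throughout.
    have : {z | BlockPositive m (a z) (S z)} =
        (⋂ p, ⋂ (_ : p ≤ m), {z | 0 ≤ blockTrace p (a z) (S z)}) ∩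
        ⋂ p, ⋂ (_ : p < m), {z | blockTrace (p + 1) (a z) (S z) ≤
          blockTrace 1 (a z) (S z) * blockTrace p (a z) (S z)} := by
      ext z
      simp only [mem_inter_iff, mem_iInter, mem_ofPred_eq]
      exact ⟨fun h => ⟨fun p hp => (h p hp).le, fun p hp => h.succ_le (hsymm z) hp⟩,
        fun h => BlockPositive.of_nonneg h.1 h.2 (hpos z)⟩
    rw [this]
    refine IsClosed.inter ?_ ?_
    · exact isClosed_iInter fun p => isClosed_iInter fun _ =>
        isClosed_le continuous_const (hcont p)
    · exact isClosed_iInter fun p => isClosed_iInter fun _ =>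
        isClosed_le (hcont _) ((hcont 1).mul (hcont p))
  have := IsClopen.eq_univ ⟨hclosed, hopen⟩ ⟨z₀, h₀⟩
  exact (Set.ext_iff.1 this z).2 (mem_univ z)

end MHessian

/-! ### Admissibility of the solution and comparison with barriers -/

namespace MHessian

open Matrix Filter Topology Set

theorem blockTrace_smul {n : ℕ} (k : ℕ) (a c : ℝ) (S : Matrix (Fin n) (Fin n) ℝ) :
    blockTrace (k + 1) a (c • S) = a * (c ^ k * pTrace k S) + c ^ (k + 1) * pTrace (k + 1) S := by
  rw [blockTrace, pTrace_smul, pTrace_smul]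

theorem IsPositive.smul {n m : ℕ} {c : ℝ} {S : Matrix (Fin n) (Fin n) ℝ} (hS : IsPositive m S)
    (hc : 0 < c) : IsPositive m (c • S) :=
  ⟨hS.1.smul c, fun p h1 h2 => by
    rw [pTrace_smul]; exact mul_pos (pow_pos hc p) (hS.2 p h1 h2)⟩

theorem IsPositive.mono {n m k : ℕ} {S : Matrix (Fin n) (Fin n) ℝ} (hS : IsPositive m S)
    (hk : k ≤ m) : IsPositive k S :=
  ⟨hS.1, fun p h1 h2 => hS.2 p h1 (h2.trans hk)⟩

variable {n : ℕ} {Ω : Set (EuclideanSpace ℝ (Fin n))}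

/-- The solutions of the evolution equation are admissible for all times. -/
theorem blockPositive_of_evolution {k : ℕ} (hΩ : IsOpen Ω) (hconn : IsConnected Ω)
    {u : EuclideanSpace ℝ (Fin n) → ℝ → ℝ}
    {ut : EuclideanSpace ℝ (Fin n) → ℝ → ℝ}
    {ux : EuclideanSpace ℝ (Fin n) → ℝ → EuclideanSpace ℝ (Fin n)}
    {uxx : EuclideanSpace ℝ (Fin n) → ℝ → Matrix (Fin n) (Fin n) ℝ}
    (hut : ContinuousOn (Function.uncurry ut) (closure Ω ×ˢ Ici 0))
    (huxx : ContinuousOn (Function.uncurry uxx) (closure Ω ×ˢ Ici 0))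
    (hd : ∀ x ∈ Ω, ∀ t : ℝ, 0 ≤ t →
      HasGradientAt (fun y => u y t) (ux x t) x ∧
      HasFDerivAt (fun y => ux y t) (Matrix.toEuclideanCLM (𝕜 := ℝ) (uxx x t)) x)
    {ν : ℝ} (hν : 0 < ν)
    (hE : ∀ x ∈ Ω, ∀ t : ℝ, 0 < t → ν ≤ blockTrace (k + 1) (-ut x t) (uxx x t))
    {x₀ : EuclideanSpace ℝ (Fin n)} (hx₀ : x₀ ∈ Ω) (h₀ : IsPositive k (uxx x₀ 0))
    {x : EuclideanSpace ℝ (Fin n)} (hx : x ∈ Ω) {t : ℝ} (ht : 0 ≤ t) :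
    BlockPositive (k + 1) (-ut x t) (uxx x t) := by
  set D : Set (EuclideanSpace ℝ (Fin n) × ℝ) := Ω ×ˢ Ici 0 with hD
  have hsub : D ⊆ closure Ω ×ˢ Ici 0 := prod_mono_left subset_closure
  have hpre : IsPreconnected D := hconn.isPreconnected.prod isPreconnected_Ici
  have : PreconnectedSpace D := isPreconnected_iff_preconnectedSpace.1 hpre
  have hpos : ∀ x ∈ Ω, ∀ t : ℝ, 0 ≤ t → 0 < blockTrace (k + 1) (-ut x t) (uxx x t) := by
    intro x hx t ht
    -- The equation is only given for `t > 0`; the uniform bound `ν` keeps the trace positive in the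
    -- limit at `t = 0`.
    refine hν.trans_le ?_
    rcases ht.eq_or_lt with rfl | ht
    · have hline : ContinuousOn (fun s : ℝ => (x, s)) (Ici 0) := by fun_prop
      have hmaps : MapsTo (fun s : ℝ => (x, s)) (Ici 0) (closure Ω ×ˢ Ici 0) := fun s hs =>
        ⟨subset_closure hx, hs⟩
      have hc : ContinuousOn (fun s => blockTrace (k + 1) (-ut x s) (uxx x s)) (Ici 0) :=
        (continuous_blockTrace (k + 1)).comp_continuousOn
          ((hut.comp hline hmaps).neg.prodMk (huxx.comp hline hmaps))
      have hlim : Tendsto (fun s => blockTrace (k + 1) (-ut x s) (uxx x s)) (𝓝[>] 0)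
          (𝓝 (blockTrace (k + 1) (-ut x 0) (uxx x 0))) :=
        ((hc 0 self_mem_Ici).mono Ioi_subset_Ici_self).tendsto
      refine ge_of_tendsto hlim ?_
      filter_upwards [self_mem_nhdsWithin] with s hs using hE x hx s hs
    · exact hE x hx t ht
  refine BlockPositive.of_preconnected (Z := D) (a := fun z => -ut z.1.1 z.1.2)
    (S := fun z => uxx z.1.1 z.1.2) (z₀ := ⟨(x₀, 0), hx₀, self_mem_Ici⟩)
    (continuousOn_iff_continuous_domRestrict.1 (hut.mono hsub)).neg
    (continuousOn_iff_continuous_domRestrict.1 (huxx.mono hsub)) ?_ ?_ ?_ ⟨(x, t), hx, ht⟩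
  · rintro ⟨⟨y, s⟩, hy, hs⟩
    refine isSymm_of_hasFDerivAt (v := fun y => u y s) (vx := fun y => ux y s) ?_ (hd y hy s hs).2
    filter_upwards [hΩ.mem_nhds hy] with z hz using (hd z hz s hs).1
  · rintro ⟨⟨y, s⟩, hy, hs⟩
    exact hpos y hy s hs
  · exact BlockPositive.of_isPositive h₀ (hpos x₀ hx₀ 0 le_rfl)

/-- One-sided convergence: `σ = 1` is the lower bound, `σ = -1` the upper bound. -/
theorem eventually_barrier_bound {k : ℕ} (hΩ : IsOpen Ω) (hb : Bornology.IsBounded Ω)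
    {f φ : EuclideanSpace ℝ (Fin n) → ℝ → ℝ} {F Φ U : EuclideanSpace ℝ (Fin n) → ℝ}
    {u ut : EuclideanSpace ℝ (Fin n) → ℝ → ℝ}
    {ux : EuclideanSpace ℝ (Fin n) → ℝ → EuclideanSpace ℝ (Fin n)}
    {uxx : EuclideanSpace ℝ (Fin n) → ℝ → Matrix (Fin n) (Fin n) ℝ}
    {Ux : EuclideanSpace ℝ (Fin n) → EuclideanSpace ℝ (Fin n)}
    {Uxx : EuclideanSpace ℝ (Fin n) → Matrix (Fin n) (Fin n) ℝ}
    (hu : ContinuousOn (Function.uncurry u) (closure Ω ×ˢ Ici 0))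
    (hd : ∀ x ∈ Ω, ∀ t : ℝ, 0 < t → HasDerivAt (u x) (ut x t) t ∧
      HasGradientAt (fun y => u y t) (ux x t) x ∧
      HasFDerivAt (fun y => ux y t) (Matrix.toEuclideanCLM (𝕜 := ℝ) (uxx x t)) x)
    (hupos : ∀ x ∈ Ω, ∀ t : ℝ, 0 < t → BlockPositive (k + 1) (-ut x t) (uxx x t))
    (hE : ∀ x ∈ Ω, ∀ t : ℝ, 0 < t → blockTrace (k + 1) (-ut x t) (uxx x t) = f x t)
    (husymm : ∀ x ∈ Ω, ∀ t : ℝ, 0 < t → (uxx x t).IsSymm)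
    (hubd : ∀ x ∈ frontier Ω, ∀ t : ℝ, 0 < t → u x t = φ x t)
    (hU : IsC2With Ω U Ux Uxx) (hUpos : ∀ x ∈ closure Ω, IsPositive (k + 1) (Uxx x))
    (hF : ∀ x ∈ Ω, pTrace (k + 1) (Uxx x) = F x) (hUbd : ∀ x ∈ frontier Ω, U x = Φ x)
    (hflim : TendstoUniformlyOn (fun t x => f x t) F atTop Ω)
    (hφlim : TendstoUniformlyOn (fun t x => φ x t) Φ atTop (frontier Ω))
    {σ : ℝ} (hσ : σ = 1 ∨ σ = -1) {ρ : ℝ} (hρ : 0 < ρ) :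
    ∀ᶠ t in atTop, ∀ x ∈ closure Ω, -ρ < σ * (u x t - U x) := by
  rcases (closure Ω).eq_empty_or_nonempty with hemp | hne
  · simp [hemp]
  have hK : IsCompact (closure Ω) := hb.isCompact_closure
  obtain ⟨c, hc, hcF⟩ : ∃ c > 0, ∀ x ∈ closure Ω, c ≤ pTrace (k + 1) (Uxx x) := by
    obtain ⟨y, hy, hmin⟩ := hK.exists_isMinOn hne
      ((continuous_pTrace (k + 1)).comp_continuousOn hU.continuousOn_vxx)
    exact ⟨_, (hUpos y hy).2 (k + 1) (by omega) le_rfl, fun x hx => hmin hx⟩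
  obtain ⟨Q, hQ⟩ : ∃ Q, ∀ x ∈ closure Ω, |pTrace k (Uxx x)| ≤ Q := by
    obtain ⟨Q, hQ⟩ := hK.exists_bound_of_continuousOn
      ((continuous_pTrace k).comp_continuousOn hU.continuousOn_vxx)
    exact ⟨Q, fun x hx => hQ x hx⟩
  obtain ⟨K, hKU⟩ : ∃ K, ∀ x ∈ closure Ω, |U x| ≤ K := by
    obtain ⟨K, hK⟩ := hK.exists_bound_of_continuousOn hU.continuousOn
    exact ⟨K, fun x hx => hK x hx⟩
  have hQ0 : 0 ≤ Q := (abs_nonneg _).trans (hQ _ hne.some_mem)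
  have hK0 : 0 ≤ K := (abs_nonneg _).trans (hKU _ hne.some_mem)
  have hTk : ∀ x ∈ closure Ω, 0 ≤ pTrace k (Uxx x) := by
    intro x hx
    rcases Nat.eq_zero_or_pos k with rfl | hk
    · rw [pTrace_zero]; exact zero_le_one
    · exact ((hUpos x hx).2 k hk (by omega)).le
  -- The final error is `2εK + δ + g`, with `εK`, `δ` and eventually `g` at most `ρ / 4`. The bound
  -- `ε ≤ 1 / 2` keeps `1 - ε` positive.
  obtain ⟨ε, hε, hε2, hεK⟩ : ∃ ε > 0, ε ≤ 1 / 2 ∧ ε * K ≤ ρ / 4 := by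
    refine ⟨min (1 / 2) (ρ / 4 / (K + 1)), by positivity, min_le_left _ _, ?_⟩
    have h1 : min (1 / 2) (ρ / 4 / (K + 1)) * (K + 1) ≤ ρ / 4 := by
      calc _ ≤ ρ / 4 / (K + 1) * (K + 1) := by gcongr; exact min_le_right _ _
        _ = ρ / 4 := by field_simp
    have h2 : 0 < min (1 / 2) (ρ / 4 / (K + 1)) := by positivity
    linarith
  -- The margin `εc` is split in half: one half for `δ`, the other for the decay term governed by
  -- `μ`.
  obtain ⟨δ, hδ, hδρ, hδc⟩ : ∃ δ > 0, δ ≤ ρ / 4 ∧ δ ≤ ε * c / 2 :=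
    ⟨min (ρ / 4) (ε * c / 2), by positivity, min_le_left _ _, min_le_right _ _⟩
  obtain ⟨T, hT⟩ := eventually_atTop.1
    ((eventually_ge_atTop (1 : ℝ)).and ((Metric.tendstoUniformlyOn_iff.1 hflim δ hδ).and
      (Metric.tendstoUniformlyOn_iff.1 hφlim δ hδ)))
  have hT1 : 1 ≤ T := (hT T le_rfl).1
  have hfT : ∀ t, T ≤ t → ∀ x ∈ Ω, |F x - f x t| < δ := fun t ht x hx => (hT t ht).2.1 x hx
  have hφT : ∀ t, T ≤ t → ∀ x ∈ frontier Ω, |Φ x - φ x t| < δ := fun t ht x hx =>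
    (hT t ht).2.2 x hx
  have huT : ContinuousOn (fun x => u x T) (closure Ω) :=
    hu.comp (f := fun x => (x, T)) (by fun_prop) fun x hx =>
      ⟨hx, zero_le_one.trans hT1⟩
  obtain ⟨C, hC⟩ : ∃ C, ∀ x ∈ closure Ω, |u x T - U x| ≤ C := by
    obtain ⟨C, hC⟩ := hK.exists_bound_of_continuousOn (huT.sub hU.continuousOn)
    exact ⟨C, fun x hx => hC x hx⟩
  have hC0 : 0 ≤ C := (abs_nonneg _).trans (hC _ hne.some_mem)
  set b : ℝ := 1 + σ * ε with hb_def
  have hb0 : 0 < b := by rcases hσ with rfl | rfl <;> linarith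
  -- The decay must be slow enough for `μ g` times the `k`-trace of `b • Uxx` to fit into `εc / 2`;
  -- the `+ 1` avoids a zero denominator.
  obtain ⟨μ, hμ, hμs⟩ : ∃ μ > 0, μ * (C * (b ^ k * Q)) ≤ ε * c / 2 := by
    have hP : 0 ≤ C * (b ^ k * Q) := by positivity
    refine ⟨ε * c / 2 / (C * (b ^ k * Q) + 1), by positivity, ?_⟩
    rw [div_mul_eq_mul_div, div_le_iff₀ (by positivity)]
    nlinarith [mul_pos hε hc]
  set g : ℝ → ℝ := fun t => C * Real.exp (-(μ * (t - T))) with hg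
  have hgd : ∀ t, HasDerivAt g (-(μ * g t)) t := by
    intro t
    have h1 : HasDerivAt (fun t => -(μ * (t - T))) (-μ) t := by
      exact (((hasDerivAt_id t).sub_const T).const_mul μ).neg.congr_deriv (by ring)
    exact (h1.exp.const_mul C).congr_deriv (by simp only [hg]; ring)
  have hg0 : ∀ t, 0 ≤ g t := fun t => by positivity
  have hgC : ∀ t, T ≤ t → g t ≤ C := by
    intro t ht
    refine mul_le_of_le_one_right hC0 (Real.exp_le_one_iff.2 ?_)
    have := mul_nonneg hμ.le (sub_nonneg.2 ht)
    linarith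
  have hgT : g T = C := by simp [hg]
  have hgc : Continuous g := continuous_iff_continuousAt.2 fun t => (hgd t).continuousAt
  have hglim : Tendsto g atTop (𝓝 0) := by
    have h1 : Tendsto (fun t : ℝ => μ * (t - T)) atTop atTop :=
      (tendsto_atTop_add_const_right _ (-T) tendsto_id).const_mul_atTop hμ
    simpa [hg] using (Real.tendsto_exp_neg_atTop_nhds_zero.comp h1).const_mul C
  have hσσ : σ * σ = 1 := by rcases hσ with rfl | rfl <;> norm_num
  have key : ∀ x ∈ closure Ω, ∀ t, T ≤ t →
      0 ≤ σ * (u x t - b * U x) + (ε * K + δ) + g t := by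
    intro x hx t ht
    refine nonneg_of_parabolic hΩ hb
      (w := fun x t => σ * (u x t - b * U x) + (ε * K + δ) + g t)
      (wt := fun x t => σ * ut x t - μ * g t)
      (wx := fun x t => σ • (ux x t - b • Ux x))
      (wxx := fun x t => σ • (uxx x t - b • Uxx x)) ?_ ?_ ?_ ?_ ?_ ?_ ?_ hx ht
    · have h1 : ContinuousOn (Function.uncurry u) (closure Ω ×ˢ Ici T) :=
        hu.mono (prod_mono_right (Ici_subset_Ici.2 (by linarith)))
      have h2 : ContinuousOn (fun z : EuclideanSpace ℝ (Fin n) × ℝ => U z.1)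
          (closure Ω ×ˢ Ici T) := hU.continuousOn.comp continuousOn_fst fun z hz => hz.1
      exact (((continuousOn_const.mul (h1.sub (continuousOn_const.mul h2))).add
        continuousOn_const).add (hgc.comp_continuousOn continuousOn_snd))
    · intro x hx t ht
      have h1 := (((hd x hx t (by linarith)).1.sub_const (b * U x)).const_mul σ).add_const
        (ε * K + δ)
      exact (h1.add (hgd t)).congr_deriv (by ring)
    · intro x hx t ht
      have h1 := (hd x hx t (by linarith)).2.1.hasFDerivAt
      have h2 := (hU.hasGradientAt x hx).hasFDerivAt
      have h3 := ((((h1.sub (h2.const_mul b)).const_mul σ).add_const (ε * K + δ)).add_const (g t))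
      rw [hasGradientAt_iff_hasFDerivAt]
      simpa using h3
    · intro x hx t ht
      have h1 := (hd x hx t (by linarith)).2.2
      exact ((h1.sub ((hU.hasFDerivAt x hx).const_smul b)).const_smul σ).congr_fderiv (by simp)
    · intro x hx
      have h1 := hC x hx
      have h2 := hKU x hx
      rw [abs_le] at h1 h2
      simp only [hgT, hb_def]
      have h3 : σ * (u x T - (1 + σ * ε) * U x) = σ * (u x T - U x) - (σ * σ) * (ε * U x) := by
        ring
      rw [h3, hσσ]
      have h4 : ε * U x ≤ ε * K := by gcongr; exact h2.2
      rcases hσ with rfl | rfl <;> linarith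
    · intro x hx t ht
      have h1 := hφT t ht x hx
      have h2 := hKU x hx.1
      have h5 := hg0 t
      rw [abs_lt] at h1
      rw [abs_le] at h2
      simp only [hb_def]
      have h3 : σ * (u x t - (1 + σ * ε) * U x) = σ * (u x t - U x) - (σ * σ) * (ε * U x) := by
        ring
      rw [h3, hσσ, hubd x hx t (by linarith), hUbd x hx]
      rw [hUbd x hx] at h2
      have h4 : ε * Φ x ≤ ε * K := by gcongr; exact h2.2
      rcases hσ with rfl | rfl <;> linarith
    · intro x hx t ht hwt hpsd
      have ht0 : 0 < t := by linarith
      have hxc := subset_closure hx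
      have hf := hfT t ht.le x hx
      rw [abs_lt] at hf
      have hη : 0 ≤ μ * g t := mul_nonneg hμ.le (hg0 t)
      have hηs : μ * g t * (b ^ k * pTrace k (Uxx x)) ≤ ε * c / 2 := by
        refine le_trans ?_ hμs
        rw [mul_assoc]
        gcongr
        · exact mul_nonneg (pow_pos hb0 k).le (hTk x hxc)
        · exact hgC t ht.le
        · exact (le_abs_self _).trans (hQ x hxc)
      have hcx := hcF x hxc
      have hFx := hF x hx
      -- Monotonicity starts from the smaller matrix, which must lie in the cone: for `σ = 1` it
      -- belongs to the barrier, for `σ = -1` to `u`, whose admissibility is needed there.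
      rcases hσ with rfl | rfl
      · rw [one_mul, one_smul] at *
        have hbF : F x + ε * c ≤ b ^ (k + 1) * pTrace (k + 1) (Uxx x) := by
          have h1 : b ≤ b ^ (k + 1) := le_self_pow₀ (by linarith) (by omega)
          rw [← hFx]
          nlinarith
        have hlow : F x + δ ≤ blockTrace (k + 1) (-(μ * g t)) (b • Uxx x) := by
          rw [blockTrace_smul]; linarith
        have hB : BlockPositive (k + 1) (-(μ * g t)) (b • Uxx x) :=
          BlockPositive.of_isPositive (((hUpos x hxc).mono (by omega)).smul hb0) (by linarith)
        have := hB.blockTrace_le (b := -ut x t) (S' := uxx x t) ((hUpos x hxc).1.smul b)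
          (by linarith) hpsd
        rw [hE x hx t ht0] at this
        linarith
      · have hbF : b ^ (k + 1) * pTrace (k + 1) (Uxx x) ≤ F x - ε * c := by
          have h1 : b ^ (k + 1) ≤ b := pow_le_of_le_one hb0.le (by linarith) (by omega)
          rw [← hFx]
          nlinarith
        have hup : blockTrace (k + 1) (μ * g t) (b • Uxx x) ≤ F x - δ := by
          rw [blockTrace_smul]; linarith
        have hpsd' : (b • Uxx x - uxx x t).PosSemidef := by simpa using hpsd
        have := (hupos x hx t ht0).blockTrace_le (b := μ * g t) (husymm x hx t ht0)
          (by linarith) hpsd'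
        rw [hE x hx t ht0] at this
        linarith
  filter_upwards [eventually_ge_atTop T, hglim.eventually (gt_mem_nhds (by positivity : 0 < ρ / 4))]
    with t ht hgt x hx
  have h1 := key x hx t ht
  have h2 := abs_le.1 (hKU x hx)
  have h3 : σ * (u x t - b * U x) = σ * (u x t - U x) - (σ * σ) * (ε * U x) := by
    rw [hb_def]; ring
  rw [h3, hσσ] at h1
  have h4 : -(ε * K) ≤ ε * U x := by nlinarith
  linarith

end MHessian

theorem theorem3p1 (n m : ℕ) (hm : 1 ≤ m) (hmn : m ≤ n)
    (Ω : Set (EuclideanSpace ℝ (Fin n)))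
    (hΩ_open : IsOpen Ω) (hΩ_conn : IsConnected Ω) (hΩ_bdd : Bornology.IsBounded Ω)
    (f φ : EuclideanSpace ℝ (Fin n) → ℝ → ℝ)
    (F Φ : EuclideanSpace ℝ (Fin n) → ℝ)
    (u : EuclideanSpace ℝ (Fin n) → ℝ → ℝ)
    (U : EuclideanSpace ℝ (Fin n) → ℝ)
    (ν : ℝ) (hν : 0 < ν) (hf : ∀ x ∈ Ω, ∀ t : ℝ, 0 < t → ν ≤ f x t)
    (hφ : ∃ x₀ ∈ Ω, MHessian.IsPositive (m - 1) (MHessian.hessian (fun x => φ x 0) x₀))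
    (hu : MHessian.IsC21 Ω u)
    (hu_eq : ∀ x ∈ Ω, ∀ t : ℝ, 0 < t → MHessian.evolutionOp m u x t = f x t)
    (hu_bd : ∀ x t, (x, t) ∈ MHessian.parabolicBoundary Ω → u x t = φ x t)
    (hU : MHessian.IsAdmissible m Ω U)
    (hU_eq : ∀ x ∈ Ω, MHessian.stationaryOp m U x = F x)
    (hU_bd : ∀ x ∈ frontier Ω, U x = Φ x)
    (hf_lim : TendstoUniformlyOn (fun t x => f x t) F Filter.atTop Ω)
    (hφ_lim : TendstoUniformlyOn (fun t x => φ x t) Φ Filter.atTop (frontier Ω)) :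
    TendstoUniformlyOn (fun t x => u x t) U Filter.atTop (closure Ω) := by
  obtain ⟨k, rfl⟩ : ∃ k, m = k + 1 := ⟨m - 1, by omega⟩
  obtain ⟨ut, ux, uxx, hc, hct, -, hcxx, hd⟩ := hu
  obtain ⟨Ux, Uxx, hUC, hUpos⟩ := hU
  obtain ⟨x₀, hx₀, hφ₀⟩ := hφ
  have hgrad : ∀ x ∈ Ω, ∀ t : ℝ, 0 ≤ t →
      ∀ᶠ y in nhds x, HasGradientAt (fun y => u y t) (ux y t) y := by
    intro x hx t ht
    filter_upwards [hΩ_open.mem_nhds hx] with y hy using (hd y hy t ht).2.1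
  have hdt : ∀ x ∈ Ω, ∀ t : ℝ, 0 < t → HasDerivAt (u x) (ut x t) t := fun x hx t ht =>
    (hd x hx t ht.le).1.hasDerivAt (Ici_mem_nhds ht)
  have hE : ∀ x ∈ Ω, ∀ t : ℝ, 0 < t →
      MHessian.blockTrace (k + 1) (-ut x t) (uxx x t) = f x t := by
    intro x hx t ht
    rw [← hu_eq x hx t ht, MHessian.evolutionOp,
      MHessian.hessian_eq_of_hasFDerivAt (hgrad x hx t ht.le) (hd x hx t ht.le).2.2]
    have : deriv (fun s => u x s) t = ut x t := (hdt x hx t ht).deriv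
    rw [this, MHessian.blockTrace, Nat.add_sub_cancel]
  have h₀ : MHessian.IsPositive k (uxx x₀ 0) := by
    -- Since `u` and `φ` agree on the open set `Ω` at time `0`, their Hesse matrices agree there
    -- too.
    have hloc : ∀ᶠ y in nhds x₀, HasGradientAt (fun y => φ y 0) (ux y 0) y := by
      filter_upwards [hΩ_open.mem_nhds hx₀] with y hy
      refine HasGradientAt.congr_of_eventuallyEq (hd y hy 0 le_rfl).2.1 ?_
      filter_upwards [hΩ_open.mem_nhds hy] with z hz
      exact (hu_bd z 0 (Or.inl ⟨hz, rfl⟩)).symm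
    rwa [MHessian.hessian_eq_of_hasFDerivAt hloc (hd x₀ hx₀ 0 le_rfl).2.2,
      Nat.add_sub_cancel] at hφ₀
  have hpos : ∀ x ∈ Ω, ∀ t : ℝ, 0 < t →
      MHessian.BlockPositive (k + 1) (-ut x t) (uxx x t) := fun x hx t ht =>
    MHessian.blockPositive_of_evolution hΩ_open hΩ_conn hct hcxx
      (fun x hx t ht => (hd x hx t ht).2) hν
      (fun x hx t ht => (hE x hx t ht).symm ▸ hf x hx t ht) hx₀ h₀ hx ht.le
  have hUF : ∀ x ∈ Ω, MHessian.pTrace (k + 1) (Uxx x) = F x := by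
    intro x hx
    have : ∀ᶠ y in nhds x, HasGradientAt U (Ux y) y := by
      filter_upwards [hΩ_open.mem_nhds hx] with y hy using hUC.hasGradientAt y hy
    rw [← hU_eq x hx, MHessian.stationaryOp,
      MHessian.hessian_eq_of_hasFDerivAt this (hUC.hasFDerivAt x hx)]
  have hbound : ∀ σ : ℝ, (σ = 1 ∨ σ = -1) → ∀ ρ > 0,
      ∀ᶠ t in Filter.atTop, ∀ x ∈ closure Ω, -ρ < σ * (u x t - U x) := fun σ hσ ρ hρ =>
    MHessian.eventually_barrier_bound hΩ_open hΩ_bdd hc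
      (fun x hx t ht => ⟨hdt x hx t ht, (hd x hx t ht.le).2⟩) hpos hE
      (fun x hx t ht => MHessian.isSymm_of_hasFDerivAt (hgrad x hx t ht.le) (hd x hx t ht.le).2.2)
      (fun x hx t ht => hu_bd x t (Or.inr ⟨hx, ht.le⟩)) hUC hUpos hUF hU_bd hf_lim hφ_lim hσ hρ
  rw [Metric.tendstoUniformlyOn_iff]
  intro ρ hρ
  filter_upwards [hbound 1 (Or.inl rfl) ρ hρ, hbound (-1) (Or.inr rfl) ρ hρ] with t h1 h2 x hx
  have h1 := h1 x hx
  have h2 := h2 x hx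
  rw [Real.dist_eq, abs_lt]
  constructor <;> linarith
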